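/- **Setting.** Let $q\ge 2$ be an integer (repetition factor) and let $\rho\in(0,1]$ be the fraction of parity bits that survive random puncturing. Consider the generalized spatially coupled parallel concatenated code (GSC-PCC) ensemble with repetition ratio $\lambda=1/q$ (every information bit is repeated $q$ times before encoding), coupling memory $m$, coupling length $L$, and upper and lower component encoders both equal to the rate-$1/2$ recursive systematic convolutional encoder with generator $(1,1/3)$ in octal notation, i.e. with parity recursion $v_t=v_{t-1}+u_t$ over $\mathbb F_2$, started in the zero state (so the mother code has rate $R_0=1/3$). As $L\to\infty$ its rate is $$R=\frac{1-(q-1)\lambda}{\left(\frac1{R_0}-1\right)\rho+1-(q-1)\lambda}=\frac{1}{2q\rho+1},\qquad\text{so that}\qquad \tfrac1{2q+1}\le R<1 .$$ *Transfer function.* For $x,y\in[0,1]$ let $f_{\rm s}(x,y)$ be the limit, as the block length tends to infinity, of the average over the information bits of the extrinsic output erasure probability of the optimal bitwise (BCJR) decoder of the component code, when its information and parity bits are independently erased with probabilities $x$ and $y$ respectively. *Density evolution.* On the binary erasure channel (BEC) with erasure probability $\varepsilon$, the output erasure probabilities $p^{(\ell)}_{{\rm U},t},p^{(\ell)}_{{\rm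 L},t}$ of the upper and lower component decoders at time $t$ after $\ell$ iterations of BP decoding start from $p^{(0)}_{{\rm U},t}=p^{(0)}_{{\rm L},t}=1$ and satisfy $$p^{(\ell)}_{{\rm U},t}=f_{\rm s}\Big(\frac{\varepsilon}{m+1}\sum_{k=0}^m\big(\bar p^{(\ell-1)}_{{\rm L},t-k}\big)^q\big(\bar p^{(\ell-1)}_{{\rm U},t-k}\big)^{q-1},\;1-(1-\varepsilon)\rho\Big),$$ and the same with U and L interchanged. Here $\bar p_{\bullet,t}=\frac1{m+1}\sum_{j=0}^m p_{\bullet,t+j}$ for $1\le t\le L$, and $\bar p_{\bullet,t}=0$ otherwise (the chain is initialized and terminated by known zero bits). Decoding succeeds at $\varepsilon$ if $p^{(\ell)}_{{\rm U},t}\to0$ and $p^{(\ell)}_{{\rm L},t}\to0$ as $\ell\to\infty$ for all $1\le t\le L+m$. Let $\varepsilon_{\rm BP}(m,L)$ be the supremum of the $\varepsilon\in[0,1]$ at which decoding succeeds. **Theorem.** The limit defining $f_{\rm s}(x,y)$ exists for all $x,y\in[0,1]$. For every $\varepsilon$ with $$0\le\varepsilon<(1-R)\Big(1-\frac{R}{R+q}\Big)$$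 there is an $m_0$ such that decoding succeeds at $\varepsilon$ for all $m\ge m_0$ and all $L$. Moreover the BP threshold of the ensemble satisfies $$\liminf_{m\to\infty}\,\liminf_{L\to\infty}\,\varepsilon_{\rm BP}(m,L)\;\ge\;(1-R)\Big(1-\frac{R}{R+q}\Big).$$ That is, the rate-$R$ ensemble achieves under BP decoding at least a fraction $1-\frac{R}{R+q}$ of the largest erasure probability $1-R$ at which reliable communication at rate $R$ over the BEC is possible. -/

import Mathlib

open Filter Topology

noncomputable section

namespace GSCPCC

/-! ### The 2-state component code and its decoder transfer function -/

/-- Parity sequence of the rate-`1/2` recursive systematic convolutional encoder with generator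
`(1, 1/3)` in octal notation, that is `(1, 1/(1+D))`, started in the zero state: over `𝔽₂`,
`v_t = v_{t-1} + u_t`, so `v_t = u_0 + ⋯ + u_t`. -/
def parity {n : ℕ} (u : Fin n → ZMod 2) (t : Fin n) : ZMod 2 :=
  ∑ s ∈ Finset.Iic t, u s

/-- Given the erasure patterns `eS` of the information bits and `eP` of the parity bits
(`true` means erased), the information bit at position `i` is not determined by all the unerased
code bits other than itself: two codewords that agree on all of these differ at position `i`.
On the erasure channel this is when the extrinsic output of the optimal bitwise (BCJR) decoder of
the trellis code is an erasure. -/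
def ExtrinsicErased {n : ℕ} (eS eP : Fin n → Bool) (i : Fin n) : Prop :=
  ∃ u w : Fin n → ZMod 2,
    (∀ t, t ≠ i → eS t = false → u t = w t) ∧
    (∀ t, eP t = false → parity u t = parity w t) ∧
    u i ≠ w i

/-- Probability of an erasure pattern when each bit is erased independently with probability
`x`. -/
def patternProb {n : ℕ} (x : ℝ) (e : Fin n → Bool) : ℝ :=
  ∏ t, if e t = true then x else 1 - x

open Classical in
/-- Probability that the extrinsic output at information bit `i` is an erasure, if the information
bits and the parity bits at the decoder input are independently erased with probabilities `x`
and `y`. -/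
def extrinsicErasureProb (n : ℕ) (x y : ℝ) (i : Fin n) : ℝ :=
  ∑ eS : Fin n → Bool, ∑ eP : Fin n → Bool,
    if ExtrinsicErased eS eP i then patternProb x eS * patternProb y eP else 0

/-- Output erasure probability for the information bits, averaged over the positions of a block
of length `n`. -/
def avgExtrinsicErasureProb (n : ℕ) (x y : ℝ) : ℝ :=
  (∑ i : Fin n, extrinsicErasureProb n x y i) / n

/-- The decoder transfer function `f_s(x, y)` for the information bits: the output erasure
probability as the block length tends to infinity. -/
def transferInfo (x y : ℝ) : ℝ :=
  limUnder atTop (fun n : ℕ => avgExtrinsicErasureProb n x y)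

/-! ### Rate, and density evolution of the spatially coupled ensemble -/

/-- Rate (as the coupling length tends to infinity) of the ensemble with mother code of rate `R₀`,
repetition factor `q`, repetition ratio `lam` and fraction `ρ` of surviving parity bits. -/
def designRate (R₀ : ℝ) (q : ℕ) (lam ρ : ℝ) : ℝ :=
  (1 - ((q : ℝ) - 1) * lam) / ((1 / R₀ - 1) * ρ + 1 - ((q : ℝ) - 1) * lam)

/-- Average erasure probability from the component decoders to the information node `u_t`, for
coupling memory `m` and coupling length `L`. The information bits outside the times `1, …, L` are
set to zero and known, so they are never erased. -/
def nodeAvg (m L : ℕ) (p : ℤ → ℝ) (t : ℤ) : ℝ :=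
  if 1 ≤ t ∧ t ≤ (L : ℤ) then
    (∑ j ∈ Finset.range (m + 1), p (t + (j : ℤ))) / ((m : ℝ) + 1)
  else 0

/-- One density evolution update at the factor nodes of one of the two encoders. Here `own` and
`other` are the current output erasure probabilities, as functions of time, of this component
decoder and of the other one, `f` is the transfer function of the component decoder for the
information bits, and the parity bits are erased with probability `1 - (1 - ε) ρ` because of random
puncturing. -/
def deUpdate (f : ℝ → ℝ → ℝ) (q : ℕ) (lam ρ : ℝ) (m L : ℕ) (ε : ℝ)
    (own other : ℤ → ℝ) (t : ℤ) : ℝ :=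
  f (ε / ((m : ℝ) + 1) * ∑ k ∈ Finset.range (m + 1),
      ((q : ℝ) * lam * nodeAvg m L other (t - (k : ℤ)) ^ q *
          nodeAvg m L own (t - (k : ℤ)) ^ (q - 1) +
        (1 - (q : ℝ) * lam) * nodeAvg m L other (t - (k : ℤ))))
    (1 - (1 - ε) * ρ)

/-- The output erasure probabilities `(p_U, p_L)` of the upper and the lower component decoders for
the information bits, after the given number of iterations, starting from complete erasure. -/
def deState (f : ℝ → ℝ → ℝ) (q : ℕ) (lam ρ : ℝ) (m L : ℕ) (ε : ℝ) :
    ℕ → (ℤ → ℝ) × (ℤ → ℝ)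
  | 0 => (fun _ => 1, fun _ => 1)
  | l + 1 =>
    let s := deState f q lam ρ m L ε l
    (deUpdate f q lam ρ m L ε s.1 s.2, deUpdate f q lam ρ m L ε s.2 s.1)

/-- BP decoding succeeds at channel erasure probability `ε`: the erasure probabilities at all the
component decoders, which exist at the times `1, …, L + m`, tend to zero. -/
def DecodingSucceeds (f : ℝ → ℝ → ℝ) (q : ℕ) (lam ρ : ℝ) (m L : ℕ) (ε : ℝ) : Prop :=
  ∀ t : ℤ, 1 ≤ t → t ≤ (L : ℤ) + (m : ℤ) →
    Tendsto (fun l => (deState f q lam ρ m L ε l).1 t) atTop (𝓝 0) ∧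
    Tendsto (fun l => (deState f q lam ρ m L ε l).2 t) atTop (𝓝 0)

/-- BP threshold on the erasure channel for coupling memory `m` and coupling length `L`. -/
def coupledThreshold (f : ℝ → ℝ → ℝ) (q : ℕ) (lam ρ : ℝ) (m L : ℕ) : ℝ :=
  sSup {ε : ℝ | 0 ≤ ε ∧ ε ≤ 1 ∧ DecodingSucceeds f q lam ρ m L ε}

/-- BP threshold of the ensemble in the regime `L → ∞`, `m → ∞`, `L ≫ m`. Lower limits are taken,
so that a lower bound for it holds for every limit point. -/
def bpThreshold (f : ℝ → ℝ → ℝ) (q : ℕ) (lam ρ : ℝ) : ℝ :=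
  liminf (fun m : ℕ => liminf (fun L : ℕ => coupledThreshold f q lam ρ m L) atTop) atTop

end GSCPCC

end

noncomputable section

namespace GSCPCC

/-! ### Extrinsic erasure probabilities of the accumulator -/

/-! On the erasure channel only the difference of two compatible inputs matters, and the accumulator
has two states. The probability `r` that the state is undetermined follows `r ↦ y(r + (1-r)x)`
forwards and `r ↦ x + (1-x)yr` backwards. Both recursions contract unless `x = 0` and `y = 1`, and
for `y < 1` they give `f_s(x,y) = 1 - ((1-y)/(1-y+xy))²` (`extrinsicErasureProb_eq`,
`transferInfo_eq`).

Both decoders start from the same values, so density evolution is one recursion `p = f(z)`, `f(z) =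
1 - (b/(b+cz))²`, where `z` averages `x^k`, `x` averages `p`, `k = 2q-1`, `b = (1-ε)ρ` and `c =
(1-b)ε`. A potential argument finishes. With `F` the primitive of `f`, the potential `k/(k+1)
p^(k+1) - F(p^k)` is at least `δ p^(k+1)` on `[0,1]` for some `δ > 0` as soon as `c(k+3) < b(k+1)²`
(`exists_potential_gap`). Since `c ≤ ε`, it suffices that `ε(q+1) < 2q²(1-ε)ρ`, which says that `ε`
is below the claimed bound (`rate_mul_fraction_eq`).

The chain without a right end dominates every terminated chain, and its iterates decrease to a
nondecreasing fixed point. Let `P` be the supremum of its node values. Summation by parts turns the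
sum of `x d(x^k)` into that of `p dz` and yields `k/(k+1) P^(k+1) ≤ F(P^k) + P^(k+1)/(m+1)`
(`halfLine_energy_le`). The error has the same power of `P` as the gap, so `P = 0` once `1/(m+1) <
δ`, whatever `L` is. -/

theorem parity_cons_zero {n : ℕ} (a : ZMod 2) (u : Fin n → ZMod 2) :
    parity (Fin.cons a u : Fin (n + 1) → ZMod 2) 0 = a := by
  simp [parity, show Finset.Iic (0 : Fin (n + 1)) = {0} from by ext; simp]

theorem parity_cons_succ {n : ℕ} (a : ZMod 2) (u : Fin n → ZMod 2) (t : Fin n) :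
    parity (Fin.cons a u : Fin (n + 1) → ZMod 2) t.succ = a + parity u t := by
  have key : ∀ {k : ℕ} (w : Fin k → ZMod 2) (r : Fin k),
      parity w r = ∑ s, if s ≤ r then w s else 0 := by
    intro k w r
    rw [parity, ← Finset.sum_filter]
    congr 1
    ext s
    simp
  rw [key, key, Fin.sum_univ_succ]
  simp

theorem parity_zero {n : ℕ} (t : Fin n) : parity (fun _ => (0 : ZMod 2)) t = 0 := by
  simp [parity]

theorem parity_sub {n : ℕ} (u w : Fin n → ZMod 2) (t : Fin n) :
    parity (fun s => u s - w s) t = parity u t - parity w t := by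
  simp [parity]

/-- Some difference of two input sequences that are compatible with the same observations has a
one at position `i`. The trellis states before the block differ only if `S` holds. -/
def Ambiguous {n : ℕ} (S : Prop) (eS eP : Fin n → Bool) (i : Fin n) : Prop :=
  ∃ (d : Fin n → ZMod 2) (s : ZMod 2), (s = 0 ∨ S) ∧ d i = 1 ∧
    (∀ t, t ≠ i → eS t = false → d t = 0) ∧ ∀ t, eP t = false → s + parity d t = 0

/-- Two different trellis states before the block are compatible with the same observations. -/
def Continuable {n : ℕ} (eS eP : Fin n → Bool) : Prop :=
  ∃ d : Fin n → ZMod 2, (∀ t, eS t = false → d t = 0) ∧ ∀ t, eP t = false → 1 + parity d t = 0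

theorem zmod_two_eq_one_of_ne_zero {a : ZMod 2} (h : a ≠ 0) : a = 1 := by
  revert a; decide

/-- By linearity a pair of inputs may be replaced by its difference and zero. The known initial
state is the case `S = False`. -/
theorem extrinsicErased_iff_ambiguous {n : ℕ} (eS eP : Fin n → Bool) (i : Fin n) :
    ExtrinsicErased eS eP i ↔ Ambiguous False eS eP i := by
  constructor
  · rintro ⟨u, w, h1, h2, h3⟩
    refine ⟨fun s => u s - w s, 0, Or.inl rfl, ?_, ?_, ?_⟩
    · exact zmod_two_eq_one_of_ne_zero (sub_ne_zero.2 h3)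
    · intro t ht he
      simp [h1 t ht he]
    · intro t he
      rw [parity_sub, h2 t he]
      simp
  · rintro ⟨d, s, hs, h1, h2, h3⟩
    obtain rfl : s = 0 := by simpa using hs
    refine ⟨d, fun _ => 0, h2, ?_, by simp [h1]⟩
    intro t he
    have := h3 t he
    rw [parity_zero]
    simpa using this

/-- The forward step: a state difference survives a section only if the parity bit is erased, and it
comes either from the earlier state or from an erased input bit. -/
theorem ambiguous_cons_succ {n : ℕ} (S : Prop) (a c : Bool) (eS eP : Fin n → Bool) (i : Fin n) :
    Ambiguous S (Fin.cons a eS : Fin (n + 1) → Bool) (Fin.cons c eP : Fin (n + 1) → Bool) i.succ ↔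
      Ambiguous (c = true ∧ (S ∨ a = true)) eS eP i := by
  constructor
  · rintro ⟨d, s, hs, h1, h2, h3⟩
    obtain ⟨d0, d', rfl⟩ : ∃ d0 d', d = Fin.cons d0 d' := ⟨d 0, Fin.tail d, (Fin.cons_self_tail d).symm⟩
    refine ⟨d', s + d0, ?_, by simpa using h1, ?_, ?_⟩
    · have hp := h3 0
      have hq := h2 0 (Fin.succ_ne_zero i).symm
      simp only [Fin.cons_zero, parity_cons_zero] at hp hq
      cases c
      · exact Or.inl (hp rfl)
      · cases a
        · rw [hq rfl, add_zero]
          simpa using hs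
        · simp
    · intro t ht he
      simpa using h2 t.succ (by simpa using ht) (by simpa using he)
    · intro t he
      have := h3 t.succ (by simpa using he)
      rwa [parity_cons_succ, ← add_assoc] at this
  · rintro ⟨d, s, hs, h1, h2, h3⟩
    have main : ∀ s0 d0 : ZMod 2, s0 + d0 = s → (s0 = 0 ∨ S) → (a = false → d0 = 0) →
        (c = false → s = 0) → Ambiguous S (Fin.cons a eS : Fin (n + 1) → Bool)
          (Fin.cons c eP : Fin (n + 1) → Bool) i.succ := by
      intro s0 d0 hsum hS ha hc
      refine ⟨Fin.cons d0 d, s0, hS, by simpa using h1, ?_, ?_⟩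
      · refine Fin.cases ?_ ?_
        · intro _ he
          simpa using ha (by simpa using he)
        · intro t ht he
          simpa using h2 t (by simpa using ht) (by simpa using he)
      · refine Fin.cases ?_ ?_
        · intro he
          rw [parity_cons_zero, hsum]
          exact hc (by simpa using he)
        · intro t he
          rw [parity_cons_succ, ← add_assoc, hsum]
          exact h3 t (by simpa using he)
    rcases hs with rfl | ⟨hc, hS | ha⟩
    · exact main 0 0 (by simp) (Or.inl rfl) (fun _ => rfl) (fun _ => rfl)
    · exact main s 0 (by simp) (Or.inr hS) (fun _ => rfl) (by simp [hc])
    · exact main 0 s (by simp) (Or.inl rfl) (by simp [ha]) (by simp [hc])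

/-- If the state may differ, flipping state and input bit together leaves the next state unchanged,
so no observation sees it. Otherwise the flip changes the next state and must be hidden by the
parity bit and by all later sections. -/
theorem ambiguous_cons_zero {n : ℕ} (S : Prop) (a c : Bool) (eS eP : Fin n → Bool) :
    Ambiguous S (Fin.cons a eS : Fin (n + 1) → Bool) (Fin.cons c eP : Fin (n + 1) → Bool) 0 ↔
      S ∨ (c = true ∧ Continuable eS eP) := by
  constructor
  · rintro ⟨d, s, hs, h1, h2, h3⟩
    obtain ⟨d0, d', rfl⟩ : ∃ d0 d', d = Fin.cons d0 d' := ⟨d 0, Fin.tail d, (Fin.cons_self_tail d).symm⟩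
    obtain rfl : d0 = 1 := by simpa using h1
    rcases hs with rfl | hS
    · refine Or.inr ⟨?_, d', ?_, ?_⟩
      · have := h3 0
        rw [parity_cons_zero] at this
        cases c <;> simp_all
      · intro t he
        simpa using h2 t.succ (Fin.succ_ne_zero t) (by simpa using he)
      · intro t he
        have := h3 t.succ (by simpa using he)
        rwa [parity_cons_succ, zero_add] at this
    · exact Or.inl hS
  · rintro (hS | ⟨hc, d, h1, h2⟩)
    · refine ⟨Fin.cons 1 (fun _ => 0), 1, Or.inr hS, by simp, ?_, ?_⟩
      · exact Fin.cases (by simp) (by simp)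
      · refine Fin.cases ?_ ?_
        · intro _
          rw [parity_cons_zero]
          decide
        · intro t _
          rw [parity_cons_succ, parity_zero]
          decide
    · refine ⟨Fin.cons 1 d, 0, Or.inl rfl, by simp, ?_, ?_⟩
      · exact Fin.cases (by simp) (fun t _ he => by simpa using h1 t (by simpa using he))
      · refine Fin.cases (by simp [hc]) ?_
        intro t he
        rw [parity_cons_succ, zero_add]
        exact h2 t (by simpa using he)

/-- The backward step: an erased input bit can merge the two states at once; failing that, the
difference must pass an erased parity bit. -/
theorem continuable_cons {n : ℕ} (a c : Bool) (eS eP : Fin n → Bool) :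
    Continuable (Fin.cons a eS : Fin (n + 1) → Bool) (Fin.cons c eP : Fin (n + 1) → Bool) ↔
      a = true ∨ (c = true ∧ Continuable eS eP) := by
  constructor
  · rintro ⟨d, h1, h2⟩
    obtain ⟨d0, d', rfl⟩ : ∃ d0 d', d = Fin.cons d0 d' := ⟨d 0, Fin.tail d, (Fin.cons_self_tail d).symm⟩
    cases a
    · obtain rfl : d0 = 0 := by simpa using h1 0
      refine Or.inr ⟨?_, d', ?_, ?_⟩
      · have := h2 0
        rw [parity_cons_zero] at this
        cases c <;> simp_all
      · intro t he
        simpa using h1 t.succ (by simpa using he)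
      · intro t he
        have := h2 t.succ (by simpa using he)
        rwa [parity_cons_succ, zero_add] at this
    · simp
  · rintro (ha | ⟨hc, d, h1, h2⟩)
    · refine ⟨Fin.cons 1 (fun _ => 0), ?_, ?_⟩
      · exact Fin.cases (by simp [ha]) (by simp)
      · refine Fin.cases ?_ ?_
        · intro _
          rw [parity_cons_zero]
          decide
        · intro t _
          rw [parity_cons_succ, parity_zero]
          decide
    · refine ⟨Fin.cons 0 d, ?_, ?_⟩
      · exact Fin.cases (by simp) (fun t he => by simpa using h1 t (by simpa using he))
      · refine Fin.cases (by simp [hc]) ?_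
        intro t he
        rw [parity_cons_succ, zero_add]
        exact h2 t (by simpa using he)

/-! ### Probabilities of the trellis events -/

open Classical in
/-- Probability of an event that depends on the erasure patterns of information and parity bits. -/
def erasureEventProb (n : ℕ) (x y : ℝ) (Q : (Fin n → Bool) → (Fin n → Bool) → Prop) : ℝ :=
  ∑ eS : Fin n → Bool, ∑ eP : Fin n → Bool,
    if Q eS eP then patternProb x eS * patternProb y eP else 0

theorem sum_fin_succ_bool {n : ℕ} (h : (Fin (n + 1) → Bool) → ℝ) :
    ∑ e, h e = ∑ e : Fin n → Bool, h (Fin.cons true e) + ∑ e : Fin n → Bool, h (Fin.cons false e) := by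
  rw [← (Fin.consEquiv (fun _ : Fin (n + 1) => Bool)).sum_comp, Fintype.sum_prod_type,
    Fintype.sum_bool]
  rfl

theorem patternProb_cons {n : ℕ} (x : ℝ) (a : Bool) (e : Fin n → Bool) :
    patternProb x (Fin.cons a e : Fin (n + 1) → Bool) =
      (if a = true then x else 1 - x) * patternProb x e := by
  simp [patternProb, Fin.prod_univ_succ]

theorem erasureEventProb_succ (n : ℕ) (x y : ℝ)
    (Q : (Fin (n + 1) → Bool) → (Fin (n + 1) → Bool) → Prop) :
    erasureEventProb (n + 1) x y Q =
      x * y * erasureEventProb n x y (fun eS eP => Q (Fin.cons true eS) (Fin.cons true eP)) +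
      (1 - x) * y * erasureEventProb n x y (fun eS eP => Q (Fin.cons false eS) (Fin.cons true eP)) +
      x * (1 - y) * erasureEventProb n x y (fun eS eP => Q (Fin.cons true eS) (Fin.cons false eP)) +
      (1 - x) * (1 - y) *
        erasureEventProb n x y (fun eS eP => Q (Fin.cons false eS) (Fin.cons false eP)) := by
  classical
  simp only [erasureEventProb, sum_fin_succ_bool, patternProb_cons, Finset.sum_add_distrib,
    Finset.mul_sum, mul_ite, mul_zero, if_true, Bool.false_eq_true, if_false, ← add_assoc]
  refine congrArg₂ (· + ·) (congrArg₂ (· + ·) (congrArg₂ (· + ·) ?_ ?_) ?_) ?_ <;>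
    refine Finset.sum_congr rfl fun _ _ => Finset.sum_congr rfl fun _ _ => ?_ <;>
    split_ifs <;> ring

theorem erasureEventProb_congr {n : ℕ} {x y : ℝ}
    {Q Q' : (Fin n → Bool) → (Fin n → Bool) → Prop} (h : ∀ eS eP, Q eS eP ↔ Q' eS eP) :
    erasureEventProb n x y Q = erasureEventProb n x y Q' := by
  congr 1
  funext eS eP
  exact propext (h eS eP)

theorem erasureEventProb_true (n : ℕ) (x y : ℝ) :
    erasureEventProb n x y (fun _ _ => True) = 1 := by
  induction n with
  | zero => simp [erasureEventProb, patternProb]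
  | succ n ih =>
    rw [erasureEventProb_succ, ih]
    ring

theorem erasureEventProb_false (n : ℕ) (x y : ℝ) :
    erasureEventProb n x y (fun _ _ => False) = 0 := by
  simp [erasureEventProb]

/-- Probability that the state before a block of length `n` is not determined by the block. -/
def backwardProb (x y : ℝ) (n : ℕ) : ℝ :=
  (fun r => x + (1 - x) * y * r)^[n] 1

/-- Probability that the state after a block of length `n` is not determined by the block, if the
state before the block is undetermined with probability `a`. -/
def forwardProb (x y : ℝ) (n : ℕ) (a : ℝ) : ℝ :=
  (fun r => y * (r + (1 - r) * x))^[n] a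

theorem erasureEventProb_continuable (n : ℕ) (x y : ℝ) :
    erasureEventProb n x y Continuable = backwardProb x y n := by
  induction n with
  | zero =>
    rw [erasureEventProb_congr (Q' := fun _ _ => True), erasureEventProb_true, backwardProb]
    · rfl
    · intro eS eP
      simp [Continuable]
  | succ n ih =>
    rw [erasureEventProb_succ]
    simp only [continuable_cons, true_or, Bool.false_eq_true, false_or, true_and, false_and,
      erasureEventProb_true, erasureEventProb_false]
    rw [ih, backwardProb, backwardProb, Function.iterate_succ_apply']
    ring

/-- The bit is recovered exactly when the states on both sides of it are determined, which are
independent events. Mixing the cases of known and unknown initial state with weights `1 - a` and `a`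
lets the induction close: one section replaces `a` by `y(a + (1-a)x)`. -/
theorem erasureEventProb_ambiguous (x y : ℝ) (n : ℕ) (i : Fin n) (a : ℝ) :
    (1 - a) * erasureEventProb n x y (fun eS eP => Ambiguous False eS eP i) +
      a * erasureEventProb n x y (fun eS eP => Ambiguous True eS eP i) =
      1 - (1 - forwardProb x y i a) * (1 - y * backwardProb x y (n - 1 - i)) := by
  induction n generalizing a with
  | zero => exact i.elim0
  | succ n ih =>
    induction i using Fin.cases with
    | zero =>
      rw [erasureEventProb_succ, erasureEventProb_succ]
      simp only [ambiguous_cons_zero, true_or, Bool.false_eq_true, false_or, true_and, false_and,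
        erasureEventProb_true, erasureEventProb_false]
      have h := erasureEventProb_continuable n x y
      simp only [forwardProb, Fin.val_zero, Function.iterate_zero, id, Nat.add_sub_cancel,
        Nat.sub_zero, ← h]
      ring
    | succ i =>
      rw [erasureEventProb_succ, erasureEventProb_succ]
      simp only [ambiguous_cons_succ, Bool.false_eq_true, or_false, or_true, and_true, and_false]
      have h := ih i (y * (a + (1 - a) * x))
      have e : n + 1 - 1 - (i.succ : ℕ) = n - 1 - i := by
        simp
        omega
      rw [e, Fin.val_succ, forwardProb, Function.iterate_succ_apply]
      rw [forwardProb] at h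
      rw [← h]
      ring

theorem extrinsicErasureProb_eq (n : ℕ) (x y : ℝ) (i : Fin n) :
    extrinsicErasureProb n x y i =
      1 - (1 - forwardProb x y i 0) * (1 - y * backwardProb x y (n - 1 - i)) := by
  rw [← erasureEventProb_ambiguous]
  simp only [sub_zero, one_mul, zero_mul, add_zero, ← extrinsicErased_iff_ambiguous]
  rfl

/-! ### The transfer function in closed form -/

theorem forwardProb_eq {x y : ℝ} (h : 1 - (1 - x) * y ≠ 0) (n : ℕ) :
    forwardProb x y n 0 = x * y / (1 - (1 - x) * y) * (1 - ((1 - x) * y) ^ n) := by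
  induction n with
  | zero => simp [forwardProb]
  | succ n ih =>
    have hα := div_mul_cancel₀ (x * y) h
    rw [forwardProb, Function.iterate_succ_apply', ← forwardProb, ih]
    linear_combination -hα

theorem backwardProb_eq {x y : ℝ} (h : 1 - (1 - x) * y ≠ 0) (n : ℕ) :
    backwardProb x y n = x / (1 - (1 - x) * y) +
      (1 - x / (1 - (1 - x) * y)) * ((1 - x) * y) ^ n := by
  induction n with
  | zero => simp [backwardProb]
  | succ n ih =>
    rw [backwardProb, Function.iterate_succ_apply', ← backwardProb, ih]
    field_simp
    ring

/-- Boundary effects decay from both ends of the block, so their sum stays bounded in `n` and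
disappears in the average. -/
theorem abs_sum_sub_le_of_geometric {r C : ℝ} (h0 : 0 ≤ r) (h1 : r < 1) {n : ℕ}
    (g : Fin n → ℝ) (hg : ∀ i : Fin n, |g i - C| ≤ r ^ (i : ℕ) + r ^ (n - 1 - (i : ℕ))) :
    |∑ i, g i - n * C| ≤ 2 / (1 - r) := by
  have hs : ∑ i, g i - n * C = ∑ i, (g i - C) := by simp
  have hgeo : ∑ i ∈ Finset.range n, r ^ i ≤ 1 / (1 - r) := by
    rw [one_div, ← tsum_geometric_of_lt_one h0 h1]
    exact (summable_geometric_of_lt_one h0 h1).sum_le_tsum _ (fun i _ => pow_nonneg h0 i)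
  rw [hs]
  calc |∑ i, (g i - C)| ≤ ∑ i, |g i - C| := Finset.abs_sum_le_sum_abs _ _
    _ ≤ ∑ i : Fin n, (r ^ (i : ℕ) + r ^ (n - 1 - (i : ℕ))) := Finset.sum_le_sum fun i _ => hg i
    _ = ∑ i ∈ Finset.range n, r ^ i + ∑ i ∈ Finset.range n, r ^ (n - 1 - i) := by
      rw [Fin.sum_univ_eq_sum_range (fun i => r ^ i + r ^ (n - 1 - i)), Finset.sum_add_distrib]
    _ = 2 * ∑ i ∈ Finset.range n, r ^ i := by
      rw [Finset.sum_range_reflect (fun i => r ^ i) n]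
      ring
    _ ≤ 2 * (1 / (1 - r)) := by gcongr
    _ = 2 / (1 - r) := by ring

theorem tendsto_avgExtrinsicErasureProb {x y : ℝ} (hx0 : 0 ≤ x) (hx1 : x ≤ 1) (hy0 : 0 ≤ y)
    (hy1 : y ≤ 1) (hxy : (1 - x) * y < 1) :
    Tendsto (fun n : ℕ => avgExtrinsicErasureProb n x y) atTop
      (𝓝 (1 - ((1 - y) / (1 - y + x * y)) ^ 2)) := by
  have hD : 0 < 1 - (1 - x) * y := by linarith
  have hD' := hD.ne'
  have hr0 : 0 ≤ (1 - x) * y := mul_nonneg (by linarith) hy0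
  have hden : 1 - y + x * y = 1 - (1 - x) * y := by ring
  rw [hden]
  set r := (1 - x) * y with hr
  set C := 1 - ((1 - y) / (1 - r)) ^ 2 with hC
  have hα0 : 0 ≤ x * y / (1 - r) := by positivity
  have hα1 : x * y / (1 - r) ≤ 1 := by
    rw [div_le_one hD, hr]; nlinarith
  have hβ0 : 0 ≤ (1 - y) / (1 - r) := div_nonneg (by linarith) hD.le
  have hβ1 : (1 - y) / (1 - r) ≤ 1 := by
    rw [div_le_one hD, hr]; nlinarith
  have hγ0 : 0 ≤ y * (1 - x / (1 - r)) := by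
    refine mul_nonneg hy0 (sub_nonneg.2 ?_)
    rw [div_le_one hD, hr]; nlinarith
  have hγ1 : y * (1 - x / (1 - r)) ≤ 1 := by
    have : 0 ≤ x / (1 - r) := by positivity
    nlinarith
  have hterm : ∀ n (i : Fin n), |extrinsicErasureProb n x y i - C| ≤
      r ^ (i : ℕ) + r ^ (n - 1 - (i : ℕ)) := by
    intro n i
    rw [extrinsicErasureProb_eq, forwardProb_eq hD', backwardProb_eq hD', ← hr]
    have hP0 : 0 ≤ r ^ (i : ℕ) := pow_nonneg hr0 _
    have hQ0 : 0 ≤ r ^ (n - 1 - (i : ℕ)) := pow_nonneg hr0 _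
    have hQ1 : r ^ (n - 1 - (i : ℕ)) ≤ 1 := pow_le_one₀ hr0 hxy.le
    generalize r ^ (i : ℕ) = P at *
    generalize r ^ (n - 1 - (i : ℕ)) = Q at *
    have e1 : 1 - x * y / (1 - r) * (1 - P) = (1 - y) / (1 - r) + x * y / (1 - r) * P := by
      field_simp
      rw [hr]; ring
    have e2 : 1 - y * (x / (1 - r) + (1 - x / (1 - r)) * Q) =
        (1 - y) / (1 - r) - y * (1 - x / (1 - r)) * Q := by
      field_simp
      rw [hr]; ring
    rw [e1, e2, hC]
    generalize x * y / (1 - r) = α at *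
    generalize (1 - y) / (1 - r) = β at *
    generalize y * (1 - x / (1 - r)) = γ at *
    have hid : 1 - (β + α * P) * (β - γ * Q) - (1 - β ^ 2) =
        β * γ * Q + α * γ * (P * Q) - α * β * P := by ring
    have h1 : β * γ ≤ 1 := mul_le_one₀ hβ1 hγ0 hγ1
    have h2 : α * γ ≤ 1 := mul_le_one₀ hα1 hγ0 hγ1
    have h3 : α * β ≤ 1 := mul_le_one₀ hα1 hβ0 hβ1
    have k1 : β * γ * Q ≤ Q := mul_le_of_le_one_left hQ0 h1
    have k2 : α * γ * (P * Q) ≤ P := by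
      have : P * Q ≤ P := mul_le_of_le_one_right hP0 hQ1
      exact (mul_le_of_le_one_left (by positivity) h2).trans this
    have k3 : α * β * P ≤ P := mul_le_of_le_one_left hP0 h3
    have j1 : 0 ≤ β * γ * Q := by positivity
    have j2 : 0 ≤ α * γ * (P * Q) := by positivity
    have j3 : 0 ≤ α * β * P := by positivity
    rw [hid, abs_le]
    constructor <;> linarith
  have hlim : Tendsto (fun n : ℕ => 2 / (1 - r) / (n : ℝ)) atTop (𝓝 0) :=
    tendsto_const_div_atTop_nhds_zero_nat _
  rw [tendsto_iff_dist_tendsto_zero]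
  refine squeeze_zero' (Eventually.of_forall fun _ => dist_nonneg) ?_ hlim
  filter_upwards [eventually_gt_atTop 0] with n hn
  have hn' : (0 : ℝ) < n := by exact_mod_cast hn
  rw [Real.dist_eq, avgExtrinsicErasureProb, div_sub' hn'.ne', abs_div, abs_of_pos hn']
  gcongr
  exact abs_sum_sub_le_of_geometric hr0 hxy _ (hterm n)

/-- Here `(1-x)y = 1`, so the recursions do not contract. With all parity bits erased, nothing
constrains a bit from outside. -/
theorem tendsto_avgExtrinsicErasureProb_zero_one :
    Tendsto (fun n : ℕ => avgExtrinsicErasureProb n 0 1) atTop (𝓝 1) := by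
  refine tendsto_const_nhds.congr' ?_
  filter_upwards [eventually_gt_atTop 0] with n hn
  have hb : ∀ k, backwardProb 0 1 k = 1 := by
    intro k
    induction k with
    | zero => rfl
    | succ k ih =>
      rw [backwardProb, Function.iterate_succ_apply', ← backwardProb, ih]
      norm_num
  have hn' : (n : ℝ) ≠ 0 := by exact_mod_cast hn.ne'
  simp [avgExtrinsicErasureProb, extrinsicErasureProb_eq, hb, hn']

theorem tendsto_transferInfo {x y : ℝ} (hx : x ∈ Set.Icc (0 : ℝ) 1) (hy : y ∈ Set.Icc (0 : ℝ) 1) :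
    Tendsto (fun n : ℕ => avgExtrinsicErasureProb n x y) atTop (𝓝 (transferInfo x y)) := by
  obtain ⟨hx0, hx1⟩ := hx
  obtain ⟨hy0, hy1⟩ := hy
  refine tendsto_nhds_limUnder ?_
  by_cases h : (1 - x) * y < 1
  · exact ⟨_, tendsto_avgExtrinsicErasureProb hx0 hx1 hy0 hy1 h⟩
  · obtain rfl : y = 1 := by nlinarith
    obtain rfl : x = 0 := by nlinarith
    exact ⟨_, tendsto_avgExtrinsicErasureProb_zero_one⟩

theorem transferInfo_eq {x y : ℝ} (hx0 : 0 ≤ x) (hx1 : x ≤ 1) (hy0 : 0 ≤ y) (hy1 : y < 1) :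
    transferInfo x y = 1 - ((1 - y) / (1 - y + x * y)) ^ 2 :=
  (tendsto_avgExtrinsicErasureProb hx0 hx1 hy0 hy1.le (by nlinarith)).limUnder_eq

/-! ### The single-system potential -/

/-- Transfer function of the accumulator as a function of the averaged erasure probability `z`. -/
def accTransfer (b c z : ℝ) : ℝ := 1 - (b / (b + c * z)) ^ 2

/-- The primitive of `accTransfer` that vanishes at zero. -/
def accPrimitive (b c z : ℝ) : ℝ := c * z ^ 2 / (b + c * z)

section Transfer

variable {b c : ℝ} (hb : 0 < b) (hc : 0 ≤ c)
include hb

theorem accTransfer_zero : accTransfer b c 0 = 0 := by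
  simp [accTransfer, hb.ne']

include hc

theorem accTransfer_mono {z w : ℝ} (hz : 0 ≤ z) (hzw : z ≤ w) :
    accTransfer b c z ≤ accTransfer b c w := by
  have hw : 0 ≤ w := hz.trans hzw
  unfold accTransfer
  gcongr

theorem accTransfer_nonneg {z : ℝ} (hz : 0 ≤ z) : 0 ≤ accTransfer b c z := by
  have := accTransfer_mono hb hc le_rfl hz
  rwa [accTransfer_zero hb] at this

omit hb hc in
theorem accTransfer_le_one (z : ℝ) : accTransfer b c z ≤ 1 := by
  unfold accTransfer
  linarith [sq_nonneg (b / (b + c * z))]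

theorem continuousAt_accTransfer {z : ℝ} (hz : 0 ≤ z) : ContinuousAt (accTransfer b c) z := by
  have : b + c * z ≠ 0 := by positivity
  unfold accTransfer
  fun_prop (disch := assumption)

/-- `accPrimitive` is convex with derivative `accTransfer`, so its graph lies above the tangent at
`z`. -/
theorem accTransfer_mul_le {z w : ℝ} (hz : 0 ≤ z) (hzw : z ≤ w) :
    accTransfer b c z * (w - z) ≤ accPrimitive b c w - accPrimitive b c z := by
  have hw : 0 ≤ w := hz.trans hzw
  have h1 : 0 < b + c * z := by positivity
  have h2 : 0 < b + c * w := by positivity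
  have key : accPrimitive b c w - accPrimitive b c z - accTransfer b c z * (w - z) =
      b ^ 2 * c * (w - z) ^ 2 / ((b + c * z) ^ 2 * (b + c * w)) := by
    unfold accPrimitive accTransfer
    field_simp
    ring
  have : 0 ≤ b ^ 2 * c * (w - z) ^ 2 / ((b + c * z) ^ 2 * (b + c * w)) := by positivity
  linarith

theorem accPrimitive_mono {z w : ℝ} (hz : 0 ≤ z) (hzw : z ≤ w) :
    accPrimitive b c z ≤ accPrimitive b c w := by
  have h := accTransfer_mul_le hb hc hz hzw
  have : 0 ≤ accTransfer b c z * (w - z) :=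
    mul_nonneg (accTransfer_nonneg hb hc hz) (by linarith)
  linarith

end Transfer

/-! ### Power inequalities and the potential gap -/

/-- The graph of `t ↦ t ^ (k + 1)` lies above its tangents. -/
theorem succ_mul_pow_mul_le {a b : ℝ} (ha : 0 ≤ a) (hb : 0 ≤ b) (k : ℕ) :
    ((k : ℝ) + 1) * a ^ k * b ≤ b ^ (k + 1) + k * a ^ (k + 1) := by
  induction k with
  | zero => simp
  | succ k ih =>
    have h : 0 ≤ (b ^ (k + 1) - a ^ (k + 1)) * (b - a) := by
      rcases le_total a b with h | h
      · exact mul_nonneg (sub_nonneg.2 (pow_le_pow_left₀ ha h _)) (sub_nonneg.2 h)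
      · exact mul_nonneg_of_nonpos_of_nonpos (sub_nonpos.2 (pow_le_pow_left₀ hb h _))
          (sub_nonpos.2 h)
    have h2 := mul_le_mul_of_nonneg_left ih ha
    push_cast
    ring_nf at h h2 ⊢
    linarith

/-- The maximum over `p` is at `p = 1 - 1/k²`. Bernoulli's inequality bounds its value, leaving
`(k+1)⁴ ≤ k²(k+2)(k+3)`, that is `4k + 1 ≤ k³`, which fails for `k = 2`. -/
theorem pow_mul_sub_le {k : ℕ} (hk : 3 ≤ k) {p : ℝ} (hp : 0 ≤ p) :
    ((k : ℝ) + 1) ^ 2 * (p ^ (k - 1) * (k + 1 - k * p)) ≤ k * (k + 3) := by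
  obtain ⟨j, rfl⟩ : ∃ j, k = j + 1 := ⟨k - 1, by omega⟩
  have hj : (2 : ℝ) ≤ j := by exact_mod_cast (by omega : 2 ≤ j)
  simp only [Nat.add_sub_cancel]
  push_cast
  set κ : ℝ := (j : ℝ) + 1 with hκ
  have hκ3 : 3 ≤ κ := by linarith
  have hκ2 : 0 < κ ^ 2 - 1 := by nlinarith
  -- `s` is the reciprocal of the maximizer, so the tangent inequality `htan` is sharp there.
  set s : ℝ := 1 + 1 / (κ ^ 2 - 1) with hs
  have hs0 : 0 < s := by positivity
  have hbern : (κ + 2) / (κ + 1) ≤ s ^ j := by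
    have := one_add_mul_le_pow (a := 1 / (κ ^ 2 - 1)) (by
      have : 0 < 1 / (κ ^ 2 - 1) := by positivity
      linarith) j
    refine le_trans (le_of_eq ?_) this
    rw [show (j : ℝ) = κ - 1 by simp [hκ]]
    have h1 : κ - 1 ≠ 0 := by linarith
    have h2 : κ + 1 ≠ 0 := by linarith
    rw [show κ ^ 2 - 1 = (κ - 1) * (κ + 1) by ring]
    field_simp
    ring
  have htan := succ_mul_pow_mul_le (a := s * p) (b := 1) (by positivity) zero_le_one j
  have hX : s ^ j * (p ^ j * (κ + 1 - κ * p)) ≤ (κ + 1) / κ := by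
    have hsp : s * (κ ^ 2 - 1) = κ ^ 2 := by
      rw [hs]; field_simp; ring
    rw [le_div_iff₀ (by linarith)]
    have h3 : (κ ^ 2 - 1) * (s * p) = κ ^ 2 * p := by linear_combination p * hsp
    rw [show (j : ℝ) = κ - 1 by simp [hκ], one_pow, pow_succ, mul_pow] at htan
    have h4 : s ^ j * (p ^ j * (κ + 1 - κ * p)) * κ =
        (κ + 1) * ((κ - 1 + 1) * (s ^ j * p ^ j)) - s ^ j * p ^ j * (κ ^ 2 * p) := by ring
    rw [h4, ← h3]
    have h5 : (κ + 1) * ((κ - 1 + 1) * (s ^ j * p ^ j) * 1) ≤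
        (κ + 1) * (1 + (κ - 1) * (s ^ j * p ^ j * (s * p))) :=
      mul_le_mul_of_nonneg_left htan (by linarith)
    linarith
  by_cases hpos : 0 ≤ p ^ j * (κ + 1 - κ * p)
  · generalize p ^ j * (κ + 1 - κ * p) = Y at *
    have h6 : (κ + 2) / (κ + 1) * Y ≤ (κ + 1) / κ :=
      (mul_le_mul_of_nonneg_right hbern hpos).trans hX
    have h7 : Y ≤ (κ + 1) ^ 2 / (κ * (κ + 2)) := by
      rw [div_mul_eq_mul_div, div_le_div_iff₀ (by linarith) (by linarith)] at h6
      rw [le_div_iff₀ (by positivity)]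
      linarith
    calc (κ + 1) ^ 2 * Y ≤ (κ + 1) ^ 2 * ((κ + 1) ^ 2 / (κ * (κ + 2))) := by gcongr
      _ ≤ κ * (κ + 3) := by
        rw [← mul_div_assoc, div_le_iff₀ (by positivity)]
        nlinarith [mul_nonneg (sub_nonneg.2 hκ3) (sub_nonneg.2 hκ3),
          mul_nonneg (mul_nonneg (sub_nonneg.2 hκ3) (sub_nonneg.2 hκ3)) (sub_nonneg.2 hκ3)]
  · have : 0 ≤ κ * (κ + 3) := by positivity
    have : (κ + 1) ^ 2 * (p ^ j * (κ + 1 - κ * p)) ≤ 0 :=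
      mul_nonpos_of_nonneg_of_nonpos (by positivity) (not_le.1 hpos).le
    linarith

/-- The potential of the uncoupled recursion is bounded below by a multiple of `p ^ (k + 1)`. -/
theorem exists_potential_gap {b c : ℝ} (hb : 0 < b) (hc : 0 ≤ c) {k : ℕ} (hk : 3 ≤ k)
    (h : c * (k + 3) < b * (k + 1) ^ 2) :
    ∃ δ : ℝ, 0 < δ ∧ ∀ p : ℝ, 0 ≤ p → p ≤ 1 →
      accPrimitive b c (p ^ k) + δ * p ^ (k + 1) ≤ k / (k + 1) * p ^ (k + 1) := by
  have hk0 : (0 : ℝ) < k := by exact_mod_cast (by omega : 0 < k)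
  -- The slack left after division by `p^(k+1)`, with the denominator `b + c p^k` enlarged to `b +
  -- c`.
  refine ⟨k * (b * (k + 1) ^ 2 - c * (k + 3)) / ((k + 1) ^ 3 * (b + c)), ?_, ?_⟩
  · have : 0 < b * (k + 1) ^ 2 - c * (k + 3) := by linarith
    positivity
  · intro p hp0 hp1
    have hq := mul_le_mul_of_nonneg_left (pow_mul_sub_le hk hp0) hc
    obtain ⟨j, rfl⟩ : ∃ j, k = j + 1 := ⟨k - 1, by omega⟩
    simp only [Nat.add_sub_cancel] at hq
    set κ : ℝ := ((j + 1 : ℕ) : ℝ) with hκ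
    have hP0 : 0 ≤ p ^ (j + 1) := by positivity
    have hP1 : p ^ (j + 1) ≤ 1 := pow_le_one₀ hp0 hp1
    have hden : 0 < b + c * p ^ (j + 1) := by positivity
    set G := b * (κ + 1) ^ 2 - c * (κ + 3) with hG
    have hG0 : 0 < G := by linarith
    have main : c * p ^ j / (b + c * p ^ (j + 1)) + κ * G / ((κ + 1) ^ 3 * (b + c)) ≤
        κ / (κ + 1) := by
      have e1 : κ * G / ((κ + 1) ^ 3 * (b + c)) ≤
          κ * G / ((κ + 1) ^ 3 * (b + c * p ^ (j + 1))) := by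
        have : c * p ^ (j + 1) ≤ c := mul_le_of_le_one_right hc hP1
        gcongr
      refine (add_le_add_right e1 _).trans ?_
      have e2 : c * p ^ j / (b + c * p ^ (j + 1)) +
          κ * G / ((κ + 1) ^ 3 * (b + c * p ^ (j + 1))) =
          (c * p ^ j * (κ + 1) ^ 3 + κ * G) / ((κ + 1) ^ 3 * (b + c * p ^ (j + 1))) := by
        field_simp
      rw [e2, div_le_div_iff₀ (by positivity) (by positivity), hG]
      have hpp : p ^ (j + 1) = p ^ j * p := pow_succ p j
      rw [hpp]
      have e3 : c * p ^ j * (κ + 1) ^ 3 + κ * (b * (κ + 1) ^ 2 - c * (κ + 3)) ≤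
          κ * (κ + 1) ^ 2 * (b + c * (p ^ j * p)) := by
        have : c * p ^ j * (κ + 1) ^ 3 - κ * (κ + 1) ^ 2 * (c * (p ^ j * p)) =
          c * ((κ + 1) ^ 2 * (p ^ j * (κ + 1 - κ * p))) := by ring
        linarith
      have e4 := mul_le_mul_of_nonneg_right e3 (by positivity : (0 : ℝ) ≤ κ + 1)
      linarith
    have hfac : accPrimitive b c (p ^ (j + 1)) =
        c * p ^ j / (b + c * p ^ (j + 1)) * p ^ (j + 1 + 1) := by
      rw [accPrimitive]
      ring
    rw [hfac, ← add_mul]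
    gcongr

/-! ### Nondecreasing fixed points of the chain with one boundary -/

/-- Average over the outputs of the factor nodes connected to an information node of the chain
that starts at time `1` and does not end. -/
def halfLineNodeAvg (m : ℕ) (p : ℤ → ℝ) (s : ℤ) : ℝ :=
  if 1 ≤ s then (∑ j ∈ Finset.range (m + 1), p (s + (j : ℤ))) / ((m : ℝ) + 1) else 0

/-- Average of the `k`-th powers of the values at the information nodes connected to a factor
node. -/
def factorAvg (m k : ℕ) (x : ℤ → ℝ) (t : ℤ) : ℝ :=
  (∑ i ∈ Finset.range (m + 1), x (t - (i : ℤ)) ^ k) / ((m : ℝ) + 1)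

/-- Density evolution update of the chain that starts at time `1` and does not end. -/
def halfLineUpdate (b c : ℝ) (m k : ℕ) (p : ℤ → ℝ) (t : ℤ) : ℝ :=
  accTransfer b c (factorAvg m k (halfLineNodeAvg m p) t)

theorem sum_range_div_le {m : ℕ} {g : ℕ → ℝ} {C : ℝ} (h : ∀ j, g j ≤ C) :
    (∑ j ∈ Finset.range (m + 1), g j) / ((m : ℝ) + 1) ≤ C := by
  rw [div_le_iff₀ (by positivity)]
  calc ∑ j ∈ Finset.range (m + 1), g j ≤ ∑ j ∈ Finset.range (m + 1), C :=
        Finset.sum_le_sum fun _ _ => h _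
    _ = C * (m + 1) := by simp [mul_comm]

theorem le_sum_range_div {m : ℕ} {g : ℕ → ℝ} {C : ℝ} (h : ∀ j, C ≤ g j) :
    C ≤ (∑ j ∈ Finset.range (m + 1), g j) / ((m : ℝ) + 1) := by
  rw [le_div_iff₀ (by positivity)]
  calc C * (m + 1) = ∑ j ∈ Finset.range (m + 1), C := by simp [mul_comm]
    _ ≤ ∑ j ∈ Finset.range (m + 1), g j := Finset.sum_le_sum fun j _ => h j

/-! ### Energy estimate for the half-line chain -/

section HalfLine

variable {m k : ℕ} {p p' x x' : ℤ → ℝ}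

theorem halfLineNodeAvg_nonneg (h : ∀ t, 0 ≤ p t) (s : ℤ) : 0 ≤ halfLineNodeAvg m p s := by
  unfold halfLineNodeAvg
  split_ifs
  · exact le_sum_range_div fun j => h _
  · exact le_rfl

theorem halfLineNodeAvg_le_one (h : ∀ t, p t ≤ 1) (s : ℤ) : halfLineNodeAvg m p s ≤ 1 := by
  unfold halfLineNodeAvg
  split_ifs
  · exact sum_range_div_le fun j => h _
  · exact zero_le_one

theorem halfLineNodeAvg_mono (h : ∀ t, p t ≤ p' t) (s : ℤ) :
    halfLineNodeAvg m p s ≤ halfLineNodeAvg m p' s := by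
  unfold halfLineNodeAvg
  split_ifs
  · gcongr
    exact h _
  · exact le_rfl

theorem monotone_halfLineNodeAvg (h : ∀ t, 0 ≤ p t) (hp : Monotone p) :
    Monotone (halfLineNodeAvg m p) := by
  intro s t hst
  by_cases hs : 1 ≤ s
  · rw [halfLineNodeAvg, halfLineNodeAvg, if_pos hs, if_pos (hs.trans hst)]
    gcongr
    exact hp (by linarith)
  · rw [halfLineNodeAvg, if_neg hs]
    exact halfLineNodeAvg_nonneg h t

theorem factorAvg_nonneg (h : ∀ t, 0 ≤ x t) (t : ℤ) : 0 ≤ factorAvg m k x t :=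
  le_sum_range_div fun _ => pow_nonneg (h _) _

theorem factorAvg_mono (h0 : ∀ t, 0 ≤ x t) (h : ∀ t, x t ≤ x' t) (t : ℤ) :
    factorAvg m k x t ≤ factorAvg m k x' t := by
  unfold factorAvg
  gcongr
  · exact h0 _
  · exact h _

theorem monotone_factorAvg (h : ∀ t, 0 ≤ x t) (hx : Monotone x) : Monotone (factorAvg m k x) := by
  intro s t hst
  unfold factorAvg
  gcongr
  · exact h _
  · exact hx (by linarith)

theorem factorAvg_sub_factorAvg_pred (t : ℤ) :
    factorAvg m k x t - factorAvg m k x (t - 1) =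
      (x t ^ k - x (t - 1 - m) ^ k) / ((m : ℝ) + 1) := by
  have h := Finset.sum_range_sub' (fun i : ℕ => x (t - (i : ℤ)) ^ k) (m + 1)
  rw [Finset.sum_sub_distrib] at h
  rw [factorAvg, factorAvg, ← sub_div]
  congr 1
  have e1 : ∀ i : ℕ, t - 1 - (i : ℤ) = t - ((i + 1 : ℕ) : ℤ) := by
    intro i; push_cast; ring
  simp only [e1] at h ⊢
  simpa using h

/-- Abel summation over the edges between information nodes and factor nodes. -/
theorem sum_mul_avg_le (m N : ℕ) {D : ℤ → ℝ} (hD : ∀ s, 0 ≤ D s) (hp : ∀ t, 0 ≤ p t) :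
    ∑ i ∈ Finset.range N, D ((i : ℤ) + 1) *
        ((∑ j ∈ Finset.range (m + 1), p ((i : ℤ) + 1 + j)) / ((m : ℝ) + 1)) ≤
      ∑ i ∈ Finset.range (N + m), p ((i : ℤ) + 1) *
        ((∑ j ∈ Finset.range (m + 1), D ((i : ℤ) + 1 - j)) / ((m : ℝ) + 1)) := by
  have hl : ∀ (M : ℕ) (u : ℕ → ℝ) (v : ℕ → ℕ → ℝ),
      ∑ i ∈ Finset.range M, u i * ((∑ j ∈ Finset.range (m + 1), v i j) / ((m : ℝ) + 1)) =
      (∑ j ∈ Finset.range (m + 1), ∑ i ∈ Finset.range M, u i * v i j) / ((m : ℝ) + 1) := by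
    intro M u v
    rw [Finset.sum_comm, Finset.sum_div]
    refine Finset.sum_congr rfl fun i _ => ?_
    rw [← Finset.mul_sum, mul_div_assoc]
  rw [hl N (fun i => D ((i : ℤ) + 1)) (fun i j => p ((i : ℤ) + 1 + j)),
    hl (N + m) (fun i => p ((i : ℤ) + 1)) (fun i j => D ((i : ℤ) + 1 - j))]
  refine div_le_div_of_nonneg_right (Finset.sum_le_sum fun j hj => ?_) (by positivity)
  have hj' : j ≤ m := by
    have := Finset.mem_range.1 hj
    omega
  -- For each edge offset `j` the index is shifted by `j`; the terms added at both ends are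
  -- nonnegative.
  calc ∑ i ∈ Finset.range N, D ((i : ℤ) + 1) * p ((i : ℤ) + 1 + j)
      = ∑ i ∈ Finset.range N, p (((j + i : ℕ) : ℤ) + 1) * D (((j + i : ℕ) : ℤ) + 1 - j) := by
        refine Finset.sum_congr rfl fun i _ => ?_
        rw [mul_comm]
        congr 2 <;> push_cast <;> ring
    _ ≤ ∑ i ∈ Finset.range j, p ((i : ℤ) + 1) * D ((i : ℤ) + 1 - j) +
        ∑ i ∈ Finset.range N, p (((j + i : ℕ) : ℤ) + 1) * D (((j + i : ℕ) : ℤ) + 1 - j) :=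
        le_add_of_nonneg_left (Finset.sum_nonneg fun i _ => mul_nonneg (hp _) (hD _))
    _ = ∑ i ∈ Finset.range (j + N), p ((i : ℤ) + 1) * D ((i : ℤ) + 1 - j) :=
        (Finset.sum_range_add (fun i : ℕ => p ((i : ℤ) + 1) * D ((i : ℤ) + 1 - j)) j N).symm
    _ ≤ ∑ i ∈ Finset.range (N + m), p ((i : ℤ) + 1) * D ((i : ℤ) + 1 - j) :=
        Finset.sum_le_sum_of_subset_of_nonneg (Finset.range_mono (by omega))
          fun i _ _ => mul_nonneg (hp _) (hD _)

variable {b c : ℝ} (hb : 0 < b) (hc : 0 ≤ c)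
include hb hc

/-- A discrete version of `∫ x d(x^k) = ∫ p dz`, with `k/(k+1) x^(k+1)` on the left and `F(z)` on
the right. The discretization error is of order `1/(m+1)` because one step of the window replaces
one of its `m + 1` terms. -/
theorem halfLine_energy_le (hp0 : ∀ t, 0 ≤ p t) (hp : Monotone p)
    (hfix : halfLineUpdate b c m k p = p) {P : ℝ} (hP : ∀ s, halfLineNodeAvg m p s ≤ P)
    (hk : k ≠ 0) (N : ℕ) :
    k / (k + 1) * halfLineNodeAvg m p N ^ (k + 1) ≤
      accPrimitive b c (P ^ k) + P ^ (k + 1) / (m + 1) := by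
  set x := halfLineNodeAvg m p with hx
  set z := factorAvg m k x with hz
  have hx0 : ∀ s, 0 ≤ x s := halfLineNodeAvg_nonneg hp0
  have hxm : Monotone x := monotone_halfLineNodeAvg hp0 hp
  have hz0 : ∀ t, 0 ≤ z t := factorAvg_nonneg hx0
  have hzm : Monotone z := monotone_factorAvg hx0 hxm
  have hpz : ∀ t, p t = accTransfer b c (z t) := fun t => (congrFun hfix t).symm
  have hP0 : 0 ≤ P := (hx0 0).trans (hP 0)
  have hpP : ∀ t, p t ≤ P := by
    intro t
    have h1 : p t ≤ p (max t 1) := hp (le_max_left _ _)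
    refine h1.trans (le_trans ?_ (hP (max t 1)))
    rw [hx, halfLineNodeAvg, if_pos (le_max_right _ _)]
    exact le_sum_range_div fun j => hp (by linarith [Int.natCast_nonneg j])
  have hxneg : ∀ s : ℤ, s ≤ 0 → x s = 0 := fun s hs => by
    rw [hx, halfLineNodeAvg, if_neg (by omega)]
  have hzz : z 0 = 0 := by
    rw [hz, factorAvg, Finset.sum_eq_zero, zero_div]
    intro i _
    rw [hxneg _ (by omega), zero_pow hk]
  have hzP : ∀ t, z t ≤ P ^ k := fun t =>
    sum_range_div_le fun j => pow_le_pow_left₀ (hx0 _) (hP _) k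
  have hstep : ∀ t, z t - z (t - 1) ≤ P ^ k / (m + 1) := by
    intro t
    rw [hz, factorAvg_sub_factorAvg_pred]
    have h1 := pow_le_pow_left₀ (hx0 t) (hP t) k
    have h2 := pow_nonneg (hx0 (t - 1 - m)) k
    gcongr
    linarith
  set D : ℤ → ℝ := fun s => x s ^ k - x (s - 1) ^ k with hD
  have hD0 : ∀ s, 0 ≤ D s := fun s =>
    sub_nonneg.2 (pow_le_pow_left₀ (hx0 _) (hxm (by linarith)) k)
  have hDz : ∀ t : ℤ, (∑ j ∈ Finset.range (m + 1), D (t - j)) / ((m : ℝ) + 1) = z t - z (t - 1) := by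
    intro t
    rw [hz, factorAvg, factorAvg, ← sub_div, ← Finset.sum_sub_distrib]
    congr 1
    refine Finset.sum_congr rfl fun j _ => ?_
    rw [hD]
    simp only
    rw [sub_right_comm]
  have hk1 : (0 : ℝ) < k + 1 := by positivity
  -- Convexity of `t^(k+1)` bounds each term below by a telescoping difference.
  have lower : k / (k + 1) * x N ^ (k + 1) ≤
      ∑ i ∈ Finset.range N, D ((i : ℤ) + 1) * x ((i : ℤ) + 1) := by
    have tel := Finset.sum_range_sub (fun i : ℕ => (k : ℝ) / (k + 1) * x (i : ℤ) ^ (k + 1)) N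
    simp only [Nat.cast_zero, hxneg 0 le_rfl, zero_pow (Nat.succ_ne_zero k), mul_zero,
      sub_zero] at tel
    rw [← tel]
    refine Finset.sum_le_sum fun i _ => ?_
    rw [hD]
    push_cast
    simp only [add_sub_cancel_right]
    have h := succ_mul_pow_mul_le (hx0 i) (hx0 (i + 1)) k
    rw [← mul_sub, div_mul_eq_mul_div, div_le_iff₀ hk1]
    rw [pow_succ (x (i + 1))] at h ⊢
    linarith
  have node : ∀ i : ℕ, x ((i : ℤ) + 1) =
      (∑ j ∈ Finset.range (m + 1), p ((i : ℤ) + 1 + j)) / ((m : ℝ) + 1) := fun i => by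
    rw [hx, halfLineNodeAvg, if_pos (by omega)]
  -- Write `p (i+1)` as `p i` plus its increment. The first part is at most an increment of
  -- `accPrimitive` by convexity, the second at most `P^k/(m+1)` times the increment of `p`; both
  -- telescope.
  have upper : ∑ i ∈ Finset.range (N + m), p ((i : ℤ) + 1) * (z ((i : ℤ) + 1) - z i) ≤
      accPrimitive b c (z (N + m : ℕ)) + P ^ k / (m + 1) * p (N + m : ℕ) := by
    have tel := Finset.sum_range_sub (fun i : ℕ => accPrimitive b c (z (i : ℤ)) +
      P ^ k / (m + 1) * p (i : ℤ)) (N + m)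
    have h0 : accPrimitive b c (z ((0 : ℕ) : ℤ)) + P ^ k / (m + 1) * p ((0 : ℕ) : ℤ) = 0 := by
      rw [hpz, Nat.cast_zero, hzz, accTransfer_zero hb]
      simp [accPrimitive]
    simp only [h0, sub_zero] at tel
    rw [← tel]
    refine Finset.sum_le_sum fun i _ => ?_
    push_cast
    have h1 := accTransfer_mul_le hb hc (hz0 i) (hzm (by linarith : (i : ℤ) ≤ i + 1))
    rw [← hpz] at h1
    have h2 := hstep (i + 1)
    rw [add_sub_cancel_right] at h2
    have h3 := mul_le_mul_of_nonneg_left h2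
      (sub_nonneg.2 (hp (by linarith : (i : ℤ) ≤ i + 1)))
    linarith
  have swap := sum_mul_avg_le m N hD0 hp0
  simp only [← node, hDz, add_sub_cancel_right] at swap
  refine (lower.trans swap).trans (upper.trans (add_le_add ?_ ?_))
  · exact accPrimitive_mono hb hc (hz0 _) (hzP _)
  · calc P ^ k / (m + 1) * p (N + m : ℕ) ≤ P ^ k / (m + 1) * P := by
          gcongr
          exact hpP _
      _ = P ^ (k + 1) / (m + 1) := by ring

/-- As `N → ∞` the energy estimate holds at the supremum `P` itself, where it contradicts the gap
unless `P = 0`. -/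
theorem halfLine_fixedPoint_eq_zero (hp0 : ∀ t, 0 ≤ p t) (hp1 : ∀ t, p t ≤ 1) (hp : Monotone p)
    (hfix : halfLineUpdate b c m k p = p) (hk : k ≠ 0) {δ : ℝ} (hδ : 1 / ((m : ℝ) + 1) < δ)
    (hgap : ∀ r : ℝ, 0 ≤ r → r ≤ 1 →
      accPrimitive b c (r ^ k) + δ * r ^ (k + 1) ≤ k / (k + 1) * r ^ (k + 1)) (t : ℤ) :
    p t = 0 := by
  set x := halfLineNodeAvg m p with hx
  have hx0 : ∀ s, 0 ≤ x s := halfLineNodeAvg_nonneg hp0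
  have hx1 : ∀ s, x s ≤ 1 := halfLineNodeAvg_le_one hp1
  have hxm : Monotone x := monotone_halfLineNodeAvg hp0 hp
  have hbdd : BddAbove (Set.range fun N : ℕ => x N) := ⟨1, by rintro _ ⟨N, rfl⟩; exact hx1 N⟩
  set P := ⨆ N : ℕ, x N with hP
  have hlim : Tendsto (fun N : ℕ => x N) atTop (𝓝 P) :=
    tendsto_atTop_ciSup (fun i j hij => hxm (by exact_mod_cast hij)) hbdd
  have hxP : ∀ s, x s ≤ P := fun s =>
    (hxm (Int.self_le_toNat s)).trans (le_ciSup hbdd s.toNat)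
  have hP0 : 0 ≤ P := (hx0 0).trans (hxP 0)
  have hP1 : P ≤ 1 := ciSup_le fun N => hx1 N
  have hle : k / (k + 1) * P ^ (k + 1) ≤ accPrimitive b c (P ^ k) + P ^ (k + 1) / (m + 1) :=
    le_of_tendsto' ((hlim.pow (k + 1)).const_mul _)
      (halfLine_energy_le hb hc hp0 hp hfix hxP hk)
  have hg := hgap P hP0 hP1
  have hPk : P ^ (k + 1) ≤ 0 := by
    have h1 : (δ - 1 / ((m : ℝ) + 1)) * P ^ (k + 1) ≤ 0 := by
      have : P ^ (k + 1) / ((m : ℝ) + 1) = 1 / ((m : ℝ) + 1) * P ^ (k + 1) := by ring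
      linarith
    by_contra hpos
    exact absurd (mul_pos (sub_pos.2 hδ) (not_le.1 hpos)) (not_lt.2 h1)
  have hPz : P = 0 := by
    by_contra hne
    exact absurd (pow_pos (lt_of_le_of_ne hP0 (Ne.symm hne)) (k + 1)) (not_lt.2 hPk)
  have hxz : ∀ s, x s = 0 := fun s => le_antisymm (hPz ▸ hxP s) (hx0 s)
  rw [← hfix, halfLineUpdate, ← hx, factorAvg]
  simp [hxz, hk, accTransfer_zero hb]

end HalfLine

/-! ### Convergence of the half-line iteration -/

section Iteration

variable {m k : ℕ} {b c : ℝ}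

/-- Density evolution of the chain that starts at time `1` and does not end. -/
def halfLineState (b c : ℝ) (m k l : ℕ) : ℤ → ℝ :=
  (halfLineUpdate b c m k)^[l] (fun _ => 1)

theorem halfLineState_succ (l : ℕ) :
    halfLineState b c m k (l + 1) = halfLineUpdate b c m k (halfLineState b c m k l) := by
  rw [halfLineState, Function.iterate_succ_apply', ← halfLineState]

theorem halfLineUpdate_le_one (p : ℤ → ℝ) (t : ℤ) : halfLineUpdate b c m k p t ≤ 1 :=
  accTransfer_le_one _

theorem halfLineState_le_one (l : ℕ) (t : ℤ) : halfLineState b c m k l t ≤ 1 := by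
  cases l with
  | zero => exact le_rfl
  | succ l =>
    rw [halfLineState_succ]
    exact halfLineUpdate_le_one _ t

variable (hb : 0 < b) (hc : 0 ≤ c)
include hb hc

theorem halfLineUpdate_nonneg {p : ℤ → ℝ} (h : ∀ t, 0 ≤ p t) (t : ℤ) :
    0 ≤ halfLineUpdate b c m k p t :=
  accTransfer_nonneg hb hc (factorAvg_nonneg (halfLineNodeAvg_nonneg h) t)

theorem halfLineUpdate_mono {p p' : ℤ → ℝ} (h0 : ∀ t, 0 ≤ p t) (h : ∀ t, p t ≤ p' t) (t : ℤ) :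
    halfLineUpdate b c m k p t ≤ halfLineUpdate b c m k p' t :=
  accTransfer_mono hb hc (factorAvg_nonneg (halfLineNodeAvg_nonneg h0) t)
    (factorAvg_mono (halfLineNodeAvg_nonneg h0) (halfLineNodeAvg_mono h) t)

theorem monotone_halfLineUpdate {p : ℤ → ℝ} (h0 : ∀ t, 0 ≤ p t) (hp : Monotone p) :
    Monotone (halfLineUpdate b c m k p) := fun _ _ hst =>
  accTransfer_mono hb hc (factorAvg_nonneg (halfLineNodeAvg_nonneg h0) _)
    (monotone_factorAvg (halfLineNodeAvg_nonneg h0) (monotone_halfLineNodeAvg h0 hp) hst)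

theorem halfLineState_nonneg (l : ℕ) (t : ℤ) : 0 ≤ halfLineState b c m k l t := by
  induction l generalizing t with
  | zero => exact zero_le_one
  | succ l ih =>
    rw [halfLineState_succ]
    exact halfLineUpdate_nonneg hb hc ih t

theorem monotone_halfLineState (l : ℕ) : Monotone (halfLineState b c m k l) := by
  induction l with
  | zero => exact monotone_const
  | succ l ih =>
    rw [halfLineState_succ]
    exact monotone_halfLineUpdate hb hc (halfLineState_nonneg hb hc l) ih

theorem antitone_halfLineState (t : ℤ) : Antitone (fun l => halfLineState b c m k l t) := by
  refine antitone_nat_of_succ_le fun l => ?_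
  induction l generalizing t with
  | zero => exact halfLineState_le_one _ t
  | succ l ih =>
    rw [halfLineState_succ (l + 1), halfLineState_succ l]
    refine halfLineUpdate_mono hb hc ?_ ?_ t
    · rw [← halfLineState_succ]
      exact halfLineState_nonneg hb hc _
    · rw [← halfLineState_succ]
      exact ih

theorem tendsto_halfLineUpdate {u : ℕ → ℤ → ℝ} {p : ℤ → ℝ} (h0 : ∀ t, 0 ≤ p t)
    (h : ∀ t, Tendsto (fun l => u l t) atTop (𝓝 (p t))) (t : ℤ) :
    Tendsto (fun l => halfLineUpdate b c m k (u l) t) atTop (𝓝 (halfLineUpdate b c m k p t)) := by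
  have hnode : ∀ s, Tendsto (fun l => halfLineNodeAvg m (u l) s) atTop
      (𝓝 (halfLineNodeAvg m p s)) := by
    intro s
    unfold halfLineNodeAvg
    split_ifs
    · exact (tendsto_finsetSum _ fun j _ => h _).div_const _
    · exact tendsto_const_nhds
  have hfac : Tendsto (fun l => factorAvg m k (halfLineNodeAvg m (u l)) t) atTop
      (𝓝 (factorAvg m k (halfLineNodeAvg m p) t)) := by
    unfold factorAvg
    exact (tendsto_finsetSum _ fun i _ => (hnode _).pow k).div_const _
  exact (continuousAt_accTransfer hb hc
    (factorAvg_nonneg (halfLineNodeAvg_nonneg h0) t)).tendsto.comp hfac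

/-- The iterates decrease pointwise, and continuity makes the limit a fixed point that inherits
monotonicity in `t`. -/
theorem tendsto_halfLineState (hk : k ≠ 0) {δ : ℝ} (hδ : 1 / ((m : ℝ) + 1) < δ)
    (hgap : ∀ r : ℝ, 0 ≤ r → r ≤ 1 →
      accPrimitive b c (r ^ k) + δ * r ^ (k + 1) ≤ k / (k + 1) * r ^ (k + 1)) (t : ℤ) :
    Tendsto (fun l => halfLineState b c m k l t) atTop (𝓝 0) := by
  set p : ℤ → ℝ := fun t => ⨅ l, halfLineState b c m k l t with hp
  have hlim : ∀ t, Tendsto (fun l => halfLineState b c m k l t) atTop (𝓝 (p t)) := fun t =>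
    tendsto_atTop_ciInf (antitone_halfLineState hb hc t)
      ⟨0, by rintro _ ⟨l, rfl⟩; exact halfLineState_nonneg hb hc l t⟩
  have hp0 : ∀ t, 0 ≤ p t := fun t =>
    ge_of_tendsto' (hlim t) fun l => halfLineState_nonneg hb hc l t
  have hp1 : ∀ t, p t ≤ 1 := fun t => le_of_tendsto' (hlim t) fun l => halfLineState_le_one l t
  have hpm : Monotone p := fun s t hst =>
    le_of_tendsto_of_tendsto' (hlim s) (hlim t) fun l => monotone_halfLineState hb hc l hst
  have hfix : halfLineUpdate b c m k p = p := by
    funext t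
    have h1 := (hlim t).comp (tendsto_add_atTop_nat 1)
    have h2 := tendsto_halfLineUpdate (m := m) (k := k) hb hc hp0 hlim t
    refine tendsto_nhds_unique h2 (h1.congr fun l => ?_)
    simp only [Function.comp, halfLineState_succ]
  have := hlim t
  rwa [halfLine_fixedPoint_eq_zero hb hc hp0 hp1 hpm hfix hk hδ hgap t] at this

end Iteration

/-! ### Comparison with the terminated chain -/

theorem nodeAvg_nonneg {m L : ℕ} {p : ℤ → ℝ} (h : ∀ t, 0 ≤ p t) (s : ℤ) : 0 ≤ nodeAvg m L p s := by
  unfold nodeAvg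
  split_ifs
  · exact le_sum_range_div fun _ => h _
  · exact le_rfl

theorem nodeAvg_le_halfLineNodeAvg {m L : ℕ} {p p' : ℤ → ℝ} (h0 : ∀ t, 0 ≤ p' t)
    (h : ∀ t, p t ≤ p' t) (s : ℤ) : nodeAvg m L p s ≤ halfLineNodeAvg m p' s := by
  by_cases hs : 1 ≤ s ∧ s ≤ L
  · rw [nodeAvg, halfLineNodeAvg, if_pos hs, if_pos hs.1]
    gcongr
    exact h _
  · rw [nodeAvg, if_neg hs]
    exact halfLineNodeAvg_nonneg h0 s

/-- At `λ = 1/q` the unrepeated part has weight zero, and on equal inputs the powers `q` and `q - 1`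
merge into `2q - 1`. -/
theorem deUpdate_transferInfo {q m L : ℕ} (hq : q ≠ 0) {ρ ε : ℝ} (hρ0 : 0 < ρ) (hρ1 : ρ ≤ 1)
    (hε0 : 0 ≤ ε) (hε1 : ε < 1) {p : ℤ → ℝ} (h0 : ∀ t, 0 ≤ p t) (h1 : ∀ t, p t ≤ 1) (t : ℤ) :
    deUpdate transferInfo q (1 / (q : ℝ)) ρ m L ε p p t =
      accTransfer ((1 - ε) * ρ) ((1 - (1 - ε) * ρ) * ε)
        (factorAvg m (2 * q - 1) (nodeAvg m L p) t) := by
  have hq' : (q : ℝ) ≠ 0 := by exact_mod_cast hq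
  have hb : 0 < (1 - ε) * ρ := mul_pos (by linarith) hρ0
  have hb1 : (1 - ε) * ρ ≤ 1 := mul_le_one₀ (by linarith) hρ0.le hρ1
  have hz0 : 0 ≤ factorAvg m (2 * q - 1) (nodeAvg m L p) t := factorAvg_nonneg (nodeAvg_nonneg h0) t
  have hz1 : factorAvg m (2 * q - 1) (nodeAvg m L p) t ≤ 1 :=
    sum_range_div_le fun _ => pow_le_one₀ (nodeAvg_nonneg h0 _)
      ((nodeAvg_le_halfLineNodeAvg (p' := fun _ => 1) (fun _ => zero_le_one) h1 _).trans
        (halfLineNodeAvg_le_one (fun _ => le_rfl) _))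
  have harg : ε / ((m : ℝ) + 1) * ∑ i ∈ Finset.range (m + 1),
      ((q : ℝ) * (1 / q) * nodeAvg m L p (t - (i : ℤ)) ^ q * nodeAvg m L p (t - (i : ℤ)) ^ (q - 1) +
        (1 - (q : ℝ) * (1 / q)) * nodeAvg m L p (t - (i : ℤ))) =
      ε * factorAvg m (2 * q - 1) (nodeAvg m L p) t := by
    rw [factorAvg, div_mul_eq_mul_div, mul_div_assoc]
    congr 3
    funext i
    rw [mul_one_div_cancel hq', show 2 * q - 1 = q + (q - 1) by omega, pow_add]
    ring
  rw [deUpdate, harg, transferInfo_eq (mul_nonneg hε0 hz0) (mul_le_one₀ hε1.le hz0 hz1)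
    (by linarith) (by linarith), accTransfer]
  congr 3 <;> ring

/-- Removing the right end can only raise the node values, and the update is monotone. -/
theorem deState_bounds {q m L : ℕ} (hq : q ≠ 0) {ρ ε : ℝ} (hρ0 : 0 < ρ) (hρ1 : ρ ≤ 1)
    (hε0 : 0 ≤ ε) (hε1 : ε < 1) (l : ℕ) :
    (deState transferInfo q (1 / (q : ℝ)) ρ m L ε l).2 =
        (deState transferInfo q (1 / (q : ℝ)) ρ m L ε l).1 ∧
      ∀ t, 0 ≤ (deState transferInfo q (1 / (q : ℝ)) ρ m L ε l).1 t ∧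
        (deState transferInfo q (1 / (q : ℝ)) ρ m L ε l).1 t ≤
          halfLineState ((1 - ε) * ρ) ((1 - (1 - ε) * ρ) * ε) m (2 * q - 1) l t := by
  have hb : 0 < (1 - ε) * ρ := mul_pos (by linarith) hρ0
  have hb1 : (1 - ε) * ρ ≤ 1 := mul_le_one₀ (by linarith) hρ0.le hρ1
  have hc : 0 ≤ (1 - (1 - ε) * ρ) * ε := mul_nonneg (by linarith) hε0
  induction l with
  | zero => exact ⟨rfl, fun t => ⟨zero_le_one, le_rfl⟩⟩
  | succ l ih =>
    obtain ⟨hsymm, hbd⟩ := ih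
    have hu := deUpdate_transferInfo (m := m) (L := L) hq hρ0 hρ1 hε0 hε1 (fun t => (hbd t).1)
      (fun t => (hbd t).2.trans (halfLineState_le_one l t))
    have hz0 := factorAvg_nonneg (m := m) (k := 2 * q - 1)
      (nodeAvg_nonneg (m := m) (L := L) fun t => (hbd t).1)
    simp only [deState, hsymm, true_and]
    intro t
    rw [hu, halfLineState_succ, halfLineUpdate]
    refine ⟨accTransfer_nonneg hb hc (hz0 t), accTransfer_mono hb hc (hz0 t) ?_⟩
    exact factorAvg_mono (nodeAvg_nonneg fun t => (hbd t).1)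
      (nodeAvg_le_halfLineNodeAvg (halfLineState_nonneg hb hc l) fun t => (hbd t).2) t

theorem exists_decodingSucceeds {q : ℕ} (hq : 2 ≤ q) {ρ ε : ℝ} (hρ0 : 0 < ρ) (hρ1 : ρ ≤ 1)
    (hε0 : 0 ≤ ε) (hε1 : ε < 1) (h : ε * (q + 1) < 2 * q ^ 2 * ((1 - ε) * ρ)) :
    ∃ m₀ : ℕ, ∀ m : ℕ, m₀ ≤ m → ∀ L : ℕ,
      DecodingSucceeds transferInfo q (1 / (q : ℝ)) ρ m L ε := by
  have hb : 0 < (1 - ε) * ρ := mul_pos (by linarith) hρ0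
  have hb1 : (1 - ε) * ρ ≤ 1 := mul_le_one₀ (by linarith) hρ0.le hρ1
  have hc : 0 ≤ (1 - (1 - ε) * ρ) * ε := mul_nonneg (by linarith) hε0
  have hkq : ((2 * q - 1 : ℕ) : ℝ) = 2 * q - 1 := by
    rw [Nat.cast_sub (by omega)]
    push_cast
    ring
  -- For `k = 2q - 1` the gap condition is `c(2q+2) < 4q²b`; replacing `c` by the larger `ε` gives
  -- twice the hypothesis `h`.
  obtain ⟨δ, hδ, hgap⟩ := exists_potential_gap hb hc (k := 2 * q - 1) (by omega) (by
    rw [hkq]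
    have : (1 - (1 - ε) * ρ) * ε ≤ ε := mul_le_of_le_one_left hε0 (by linarith)
    have h2 := mul_le_mul_of_nonneg_right this (by positivity : (0 : ℝ) ≤ q + 1)
    nlinarith)
  obtain ⟨m₀, hm₀⟩ := exists_nat_one_div_lt hδ
  refine ⟨m₀, fun m hm L t _ _ => ?_⟩
  have hδm : 1 / ((m : ℝ) + 1) < δ := lt_of_le_of_lt (Nat.one_div_le_one_div hm) hm₀
  have hlim := tendsto_halfLineState hb hc (by omega : 2 * q - 1 ≠ 0) hδm hgap t
  have hst := deState_bounds (m := m) (L := L) (by omega : q ≠ 0) hρ0 hρ1 hε0 hε1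
  have h1 : Tendsto (fun l => (deState transferInfo q (1 / (q : ℝ)) ρ m L ε l).1 t) atTop (𝓝 0) :=
    squeeze_zero (fun l => ((hst l).2 t).1) (fun l => ((hst l).2 t).2) hlim
  exact ⟨h1, h1.congr fun l => by rw [(hst l).1]⟩

/-! ### Thresholds -/

theorem coupledThreshold_le_one (f : ℝ → ℝ → ℝ) (q : ℕ) (lam ρ : ℝ) (m L : ℕ) :
    coupledThreshold f q lam ρ m L ≤ 1 :=
  Real.sSup_le (fun _ h => h.2.1) zero_le_one

theorem coupledThreshold_nonneg (f : ℝ → ℝ → ℝ) (q : ℕ) (lam ρ : ℝ) (m L : ℕ) :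
    0 ≤ coupledThreshold f q lam ρ m L :=
  Real.sSup_nonneg fun _ h => h.1

/-- Since `m₀` does not depend on `L`, both lower limits see only thresholds that are at least `ε`.
The bounds by 0 and 1 are needed because real `sSup` and `liminf` are meaningful only for bounded
families. -/
theorem le_bpThreshold {f : ℝ → ℝ → ℝ} {q : ℕ} {lam ρ ε : ℝ} (hε0 : 0 ≤ ε) (hε1 : ε ≤ 1)
    (h : ∃ m₀ : ℕ, ∀ m : ℕ, m₀ ≤ m → ∀ L : ℕ, DecodingSucceeds f q lam ρ m L ε) :
    ε ≤ bpThreshold f q lam ρ := by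
  obtain ⟨m₀, hm₀⟩ := h
  have hL : ∀ m, liminf (fun L : ℕ => coupledThreshold f q lam ρ m L) atTop ≤ 1 := fun m =>
    liminf_le_of_le (isBoundedUnder_of ⟨0, fun L => coupledThreshold_nonneg f q lam ρ m L⟩)
      fun r hr => by
        obtain ⟨L, hL⟩ := hr.exists
        exact hL.trans (coupledThreshold_le_one f q lam ρ m L)
  refine le_liminf_of_le (isBoundedUnder_of ⟨1, hL⟩).isCoboundedUnder_ge ?_
  filter_upwards [eventually_ge_atTop m₀] with m hm
  refine le_liminf_of_le (isBoundedUnder_of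
    ⟨1, fun L => coupledThreshold_le_one f q lam ρ m L⟩).isCoboundedUnder_ge ?_
  exact Eventually.of_forall fun L =>
    le_csSup ⟨1, fun _ h => h.2.1⟩ ⟨hε0, hε1, hm₀ m hm L⟩

/-- The right side is the root in `ε` of `ε(q+1) = 2q²(1-ε)ρ`. -/
theorem rate_mul_fraction_eq {q : ℕ} (hq : 2 ≤ q) {ρ : ℝ} (hρ0 : 0 < ρ) :
    (1 - designRate (1 / 3) q (1 / (q : ℝ)) ρ) *
        (1 - designRate (1 / 3) q (1 / (q : ℝ)) ρ / (designRate (1 / 3) q (1 / (q : ℝ)) ρ + q)) =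
      2 * q ^ 2 * ρ / (2 * q ^ 2 * ρ + q + 1) := by
  have hq' : (0 : ℝ) < q := by exact_mod_cast (by omega : 0 < q)
  have hR : designRate (1 / 3) q (1 / (q : ℝ)) ρ = 1 / (2 * q * ρ + 1) := by
    have h1 : 1 - ((q : ℝ) - 1) * (1 / q) = 1 / q := by field_simp; ring
    have h2 : (1 / (1 / 3 : ℝ) - 1) * ρ + 1 - ((q : ℝ) - 1) * (1 / q) = (2 * q * ρ + 1) / q := by
      rw [add_sub_assoc, h1]
      field_simp
      ring
    rw [designRate, h1, h2]
    field_simp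
  have h3 : 1 / (2 * q * ρ + 1) + (q : ℝ) = (2 * q ^ 2 * ρ + q + 1) / (2 * q * ρ + 1) := by
    field_simp
    ring
  rw [hR, h3]
  field_simp
  ring

end GSCPCC

end

theorem theorem2 (q : ℕ) (hq : 2 ≤ q) (ρ : ℝ) (hρ0 : 0 < ρ) (hρ1 : ρ ≤ 1)
    (R : ℝ) (hR : R = GSCPCC.designRate (1 / 3) q (1 / (q : ℝ)) ρ) :
    (∀ x ∈ Set.Icc (0 : ℝ) 1, ∀ y ∈ Set.Icc (0 : ℝ) 1,
      Tendsto (fun n : ℕ => GSCPCC.avgExtrinsicErasureProb n x y) atTop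
        (𝓝 (GSCPCC.transferInfo x y))) ∧
    (∀ ε : ℝ, 0 ≤ ε → ε < (1 - R) * (1 - R / (R + q)) →
      ∃ m₀ : ℕ, ∀ m : ℕ, m₀ ≤ m → ∀ L : ℕ,
        GSCPCC.DecodingSucceeds GSCPCC.transferInfo q (1 / (q : ℝ)) ρ m L ε) ∧
    (1 - R) * (1 - R / (R + q)) ≤
      GSCPCC.bpThreshold GSCPCC.transferInfo q (1 / (q : ℝ)) ρ := by
  rw [hR, GSCPCC.rate_mul_fraction_eq hq hρ0]
  have hq' : (0 : ℝ) < q := by exact_mod_cast (by omega : 0 < q)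
  have hden : 0 < 2 * (q : ℝ) ^ 2 * ρ + q + 1 := by positivity
  have hlt : 2 * (q : ℝ) ^ 2 * ρ / (2 * q ^ 2 * ρ + q + 1) < 1 := by
    rw [div_lt_one hden]
    linarith
  have hpos : 0 < 2 * (q : ℝ) ^ 2 * ρ / (2 * q ^ 2 * ρ + q + 1) := by positivity
  have hdec : ∀ ε : ℝ, 0 ≤ ε → ε < 2 * (q : ℝ) ^ 2 * ρ / (2 * q ^ 2 * ρ + q + 1) →
      ∃ m₀ : ℕ, ∀ m : ℕ, m₀ ≤ m → ∀ L : ℕ,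
        GSCPCC.DecodingSucceeds GSCPCC.transferInfo q (1 / (q : ℝ)) ρ m L ε := by
    intro ε hε0 hε
    refine GSCPCC.exists_decodingSucceeds hq hρ0 hρ1 hε0 (hε.trans hlt) ?_
    rw [lt_div_iff₀ hden] at hε
    linarith
  refine ⟨fun x hx y hy => GSCPCC.tendsto_transferInfo hx hy, hdec, ?_⟩
  -- Every `ε` below the bound is compared with the threshold; negative ones are replaced by 0,
  -- where decoding is defined.
  refine le_of_forall_lt_imp_le_of_dense fun ε hε => ?_
  have hε' : max ε 0 < 2 * (q : ℝ) ^ 2 * ρ / (2 * q ^ 2 * ρ + q + 1) := max_lt hε hpos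
  exact (le_max_left ε 0).trans (GSCPCC.le_bpThreshold (le_max_right ε 0) (hε'.trans hlt).le
    (hdec _ (le_max_right ε 0) hε'))
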